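/- **Setting.** Let $d\ge 1$, let $\Omega\subset\mathbb R^d$ be open and bounded, and write $\mathcal H^{d-1}$ for the $(d-1)$-dimensional Hausdorff measure. $BV(\Omega)$ is the set of $u\in L^1(\Omega)$ whose distributional partial derivatives are finite signed measures on $\Omega$. For $u\in BV(\Omega)$ the *lower approximate limit* $u^-(x)$ at $x\in\Omega$ is - the number $a$ with $\lim_{\rho\to0^+}\frac1{|B_\rho(x)|}\int_{B_\rho(x)}|u-a|\,dy=0$, if there is one; - otherwise the number $a$ for which there are $b>a$ and a unit vector $\nu$ such that, with $B^\pm_\rho(x,\nu)=\{y\in B_\rho(x):\pm\langle y-x,\nu\rangle>0\}$, the averages of $|u-b|$ over $B_\rho^+(x,\nu)$ and of $|u-a|$ over $B_\rho^-(x,\nu)$ tend to $0$ as $\rho\to0^+$. At all other points $u^-(x)$ is undefined, and the assertion $u(x)=u^-(x)$ is understood to include that $u^-(x)$ is defined. A function $f:\mathbb R^d\times\mathbb R^d\times\mathbb R^d\to[0,+\infty)$ is *symmetric jointly convex* if there are uniformly continuous, bounded vector fields $g_j:\mathbb R^d\to\mathbb R^d$ ($j\in\mathbb N$), each the gradient of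 a $C^1$ potential, such that $f(r,t,\xi)=\sup_{j}\langle g_j(r)-g_j(t),\xi\rangle$ for all $r,t,\xi\in\mathbb R^d$. (In particular $f(r,r,\xi)=0$.) A function $\phi:\Omega\times\mathbb R^d\times\mathbb R^d\times\mathbb R^d\to[0,+\infty)$ is *BV symmetric jointly convex* if $\phi(\cdot,r,t,\xi)\in BV(\Omega)$ for all $r,t,\xi$ and there is a Borel set $N\subset\Omega$ with $\mathcal H^{d-1}(N)=0$ such that 1. $\phi(x,r,t,\xi)=\phi^-(x,r,t,\xi)$, the lower approximate limit in the variable $x$, for all $x\in\Omega\setminus N$ and all $r,t,\xi$; 2. $\phi(x,\cdot,\cdot,\cdot)$ is symmetric jointly convex for every $x\in\Omega\setminus N$; 3. there is $L>0$ such that $|\phi(x,r,t,\xi)-\phi(x,s,t,\xi)|\le L|r-s|$ for all $x\in\Omega\setminus N$ and all $r,s,t,\xi\in\mathbb R^d$ with $r\ne t$ and $s\ne t$. **Proposition 5.2.** Let $\kappa:\Omega\times\mathbb R^d\to[0,+\infty)$ be such that - $\kappa(\cdot,\xi)\in BV(\Omega)$ for every $\xi\in\mathbb R^d$, and there is a Borel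 set $N\subset\Omega$ with $\mathcal H^{d-1}(N)=0$ such that $\kappa(x,\xi)=\kappa^-(x,\xi)$ (the lower approximate limit in $x$) for all $x\in\Omega\setminus N$ and all $\xi\in\mathbb R^d$; - $\kappa(x,\cdot)$ is even, positively $1$-homogeneous and convex for every $x\in\Omega$. Let $\phi$ be given by $\phi(x,r,t,\xi)=\kappa(x,\xi)$ if $r\neq t$ and $\phi(x,r,r,\xi)=0$, and suppose that there is $c>0$ such that $\phi(x,r,t,\xi)\ge c$ for all $x\in\Omega$, all $r\ne t$ and all $\xi$ with $|\xi|=1$. Then $\phi$ is BV symmetric jointly convex. -/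

import Mathlib

open MeasureTheory Set Filter Topology
open scoped ContDiff RealInnerProductSpace

noncomputable section

namespace SurfaceIntegrand

/-- Euclidean space of dimension `d`. -/
abbrev E (d : ℕ) : Type := EuclideanSpace ℝ (Fin d)

/-- Integral of a scalar function over the set `s` with respect to a (finite) signed measure,
through the Jordan decomposition. -/
def signedSetIntegral {d : ℕ} (D : SignedMeasure (E d)) (s : Set (E d)) (ψ : E d → ℝ) : ℝ :=
  (∫ x in s, ψ x ∂D.toJordanDecomposition.posPart)
    - ∫ x in s, ψ x ∂D.toJordanDecomposition.negPart

/-- The space `BV(Ω)` of scalar functions of bounded variation: `u ∈ L¹(Ω)` and every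
distributional partial derivative of `u` in `Ω` is a finite signed measure. Only the values of
`u` in `Ω` are relevant. -/
def IsBV {d : ℕ} (Ω : Set (E d)) (u : E d → ℝ) : Prop :=
  IntegrableOn u Ω volume ∧
  ∃ D : Fin d → SignedMeasure (E d),
    ∀ (i : Fin d) (ψ : E d → ℝ), ContDiff ℝ ∞ ψ → HasCompactSupport ψ → tsupport ψ ⊆ Ω →
      ∫ x in Ω, u x * fderiv ℝ ψ x (EuclideanSpace.single i 1)
        = - signedSetIntegral (D i) Ω ψ

/-- The open half ball `{y ∈ B_ρ(x) : ⟨y - x, ν⟩ > 0}`. The opposite half ball is obtained by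
replacing `ν` by `-ν`. -/
def halfBall {d : ℕ} (x ν : E d) (ρ : ℝ) : Set (E d) :=
  {y | y ∈ Metric.ball x ρ ∧ 0 < ⟪y - x, ν⟫}

/-- `a` is the value at `x` of the precise representative of `u`. -/
def IsPreciseValue {d : ℕ} (u : E d → ℝ) (x : E d) (a : ℝ) : Prop :=
  Tendsto (fun ρ : ℝ => ⨍⁻ y in Metric.ball x ρ, ‖u y - a‖ₑ ∂volume) (𝓝[>] 0) (𝓝 0)

/-- `x` is an approximate jump point of `u` with one-sided limits `b` (in direction `ν`) and
`a` (in direction `-ν`), and `a < b`. -/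
def IsJumpAt {d : ℕ} (u : E d → ℝ) (x : E d) (b a : ℝ) (ν : E d) : Prop :=
  ‖ν‖ = 1 ∧ a < b ∧
  Tendsto (fun ρ : ℝ => ⨍⁻ y in halfBall x ν ρ, ‖u y - b‖ₑ ∂volume) (𝓝[>] 0) (𝓝 0) ∧
  Tendsto (fun ρ : ℝ => ⨍⁻ y in halfBall x (-ν) ρ, ‖u y - a‖ₑ ∂volume) (𝓝[>] 0) (𝓝 0)

/-- `a` is the lower approximate limit `u⁻(x)`: the value of the precise representative where
this exists, and the smaller one of the two one-sided limits at an approximate jump point. At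
all other points `u⁻` is not defined, so that no `a` has this property. -/
def IsLowerApproxLimit {d : ℕ} (u : E d → ℝ) (x : E d) (a : ℝ) : Prop :=
  IsPreciseValue u x a ∨ ∃ (b : ℝ) (ν : E d), IsJumpAt u x b a ν

/-- A vector field with a potential of class `C¹`. -/
def IsConservative {d : ℕ} (g : E d → E d) : Prop :=
  ∃ G : E d → ℝ, ContDiff ℝ 1 G ∧ ∀ r, HasGradientAt G (g r) r

/-- Symmetric joint convexity of `φ : ℝᵈ × ℝᵈ × ℝᵈ → [0, ∞)`. -/
def IsSymmJointlyConvex {d : ℕ} (φ : E d → E d → E d → ℝ) : Prop :=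
  (∀ r t ξ, 0 ≤ φ r t ξ) ∧
  ∃ g : ℕ → E d → E d,
    (∀ j, UniformContinuous (g j) ∧ (∃ C : ℝ, ∀ r, ‖g j r‖ ≤ C) ∧ IsConservative (g j)) ∧
    ∀ r t ξ, IsLUB (range fun j : ℕ => ⟪g j r - g j t, ξ⟫) (φ r t ξ)

/-- `u(·, p)` belongs to `BV(Ω)` for each parameter `p`, and there is an `ℋ^{d-1}`-null Borel set
`N ⊆ Ω`, the same one for all parameters, off which `u(·, p)` coincides with its lower
approximate limit. -/
def IsBVFamilyWith {d : ℕ} {P : Type} (Ω N : Set (E d)) (u : E d → P → ℝ) : Prop :=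
  (∀ p, IsBV Ω fun x => u x p) ∧
  N ⊆ Ω ∧ MeasurableSet N ∧ μH[(d : ℝ) - 1] N = 0 ∧
  ∀ x ∈ Ω \ N, ∀ p, IsLowerApproxLimit (fun y => u y p) x (u x p)

/-- BV symmetric joint convexity of `φ : Ω × ℝᵈ × ℝᵈ × ℝᵈ → [0, ∞)`. The Lipschitz condition
concerns the pairs of traces off the diagonal: on the diagonal `φ` always vanishes by symmetric
joint convexity, whatever its limit there. -/
def IsBVSymmJointlyConvex {d : ℕ} (Ω : Set (E d)) (φ : E d → E d → E d → E d → ℝ) : Prop :=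
  (∀ x ∈ Ω, ∀ r t ξ, 0 ≤ φ x r t ξ) ∧
  ∃ N : Set (E d),
    IsBVFamilyWith Ω N (fun x (p : E d × E d × E d) => φ x p.1 p.2.1 p.2.2) ∧
    (∀ x ∈ Ω \ N, IsSymmJointlyConvex (φ x)) ∧
    ∃ L : ℝ, 0 < L ∧ ∀ x ∈ Ω \ N, ∀ r s t ξ, r ≠ t → s ≠ t →
      |φ x r t ξ - φ x s t ξ| ≤ L * ‖r - s‖

end SurfaceIntegrand

end

namespace SurfaceIntegrand

/-! For fixed `x`, `κ x` is the support function of its Wulff shape `K`, which is symmetric because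
`κ x` is even. For `v ∈ K` and a ramp `h` with values in `[-1/2, 1/2]`, the ridge field `y ↦ h ⟪v,
y⟫ • v` is a bounded gradient. Its differences lie in `[-1, 1] • v ⊆ K`, so they never exceed `κ x`
(`inner_ridge_sub_le`). A difference equals `v` once a ramp separates `⟪v, r⟫` from `⟪v, t⟫`, which
requires `⟪v, r - t⟫ ≠ 0`. Coercivity puts a ball into `K`, so excluding the other `v` does not
lower the supremum (`exists_mem_wulffShape_lt_inner`). A dense sequence in `K`, integer slopes and
rational centres make the family countable. The BV conditions pass from `κ` to `φ` because each
`φ(·, r, t, ξ)` is `κ(·, ξ)` or `0` on `Ω`. -/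

variable {d : ℕ}

/-! ### Dependence on the values in an open set only -/

theorem IsBV.congr {Ω : Set (E d)} (hΩ : MeasurableSet Ω) {u w : E d → ℝ}
    (h : ∀ x ∈ Ω, w x = u x) (hu : IsBV Ω u) : IsBV Ω w := by
  obtain ⟨hint, D, hD⟩ := hu
  refine ⟨hint.congr_fun (fun x hx => (h x hx).symm) hΩ, D, fun i ψ h1 h2 h3 => ?_⟩
  rw [← hD i ψ h1 h2 h3]
  exact setIntegral_congr_fun hΩ fun x hx => by simp only [h x hx]

theorem IsBV.zero (Ω : Set (E d)) : IsBV Ω (fun _ => 0) := by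
  refine ⟨integrableOn_zero, fun _ => 0, fun i ψ _ _ _ => ?_⟩
  simp [signedSetIntegral, SignedMeasure.toJordanDecomposition_zero]

theorem halfBall_subset_ball (x ν : E d) (ρ : ℝ) : halfBall x ν ρ ⊆ Metric.ball x ρ :=
  fun _ hy => hy.1

theorem measurableSet_halfBall (x ν : E d) (ρ : ℝ) : MeasurableSet (halfBall x ν ρ) := by
  have hcont : Continuous fun y : E d => ⟪y - x, ν⟫ := by fun_prop
  exact (Metric.isOpen_ball.inter (isOpen_lt continuous_const hcont)).measurableSet

theorem tendsto_laverage_congr {Ω : Set (E d)} (hΩ : IsOpen Ω) {u w : E d → ℝ}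
    (h : ∀ x ∈ Ω, w x = u x) {x : E d} (hx : x ∈ Ω) (a : ℝ) (B : ℝ → Set (E d))
    (hBm : ∀ ρ, MeasurableSet (B ρ)) (hB : ∀ ρ, B ρ ⊆ Metric.ball x ρ)
    (hu : Tendsto (fun ρ : ℝ => ⨍⁻ y in B ρ, ‖u y - a‖ₑ ∂volume) (𝓝[>] 0) (𝓝 0)) :
    Tendsto (fun ρ : ℝ => ⨍⁻ y in B ρ, ‖w y - a‖ₑ ∂volume) (𝓝[>] 0) (𝓝 0) := by
  obtain ⟨ε, hε, hball⟩ := Metric.isOpen_iff.1 hΩ x hx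
  refine hu.congr' ?_
  filter_upwards [Ioo_mem_nhdsGT hε] with ρ hρ
  rw [setLAverage_eq, setLAverage_eq]
  congr 1
  refine setLIntegral_congr_fun (hBm ρ) fun y hy => ?_
  simp only [h y (hball (Metric.ball_subset_ball hρ.2.le (hB ρ hy)))]

theorem IsLowerApproxLimit.congr {Ω : Set (E d)} (hΩ : IsOpen Ω) {u w : E d → ℝ}
    (h : ∀ x ∈ Ω, w x = u x) {x : E d} (hx : x ∈ Ω) {a : ℝ}
    (hu : IsLowerApproxLimit u x a) : IsLowerApproxLimit w x a := by
  rcases hu with hu | ⟨b, ν, hν, hab, hb, ha⟩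
  · exact Or.inl (tendsto_laverage_congr hΩ h hx a _ (fun _ => measurableSet_ball)
      (fun _ => Subset.rfl) hu)
  · exact Or.inr ⟨b, ν, hν, hab,
      tendsto_laverage_congr hΩ h hx b _ (measurableSet_halfBall x ν)
        (halfBall_subset_ball x ν) hb,
      tendsto_laverage_congr hΩ h hx a _ (measurableSet_halfBall x (-ν))
        (halfBall_subset_ball x (-ν)) ha⟩

theorem isLowerApproxLimit_zero (x : E d) : IsLowerApproxLimit (fun _ => 0) x 0 := by
  refine Or.inl ?_
  simp [IsPreciseValue]

/-! ### Ridge fields: bounded gradients in a fixed direction -/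

/-- The ramp of slope `n` centred at `q`, truncated to `[-1/2, 1/2]`. -/
noncomputable def ramp (n q s : ℝ) : ℝ := max (-(1 / 2)) (min (1 / 2) (n * (s - q)))

theorem neg_half_le_ramp (n q s : ℝ) : -(1 / 2) ≤ ramp n q s := le_max_left _ _

theorem ramp_le_half (n q s : ℝ) : ramp n q s ≤ 1 / 2 :=
  max_le (by norm_num) (min_le_left _ _)

theorem uniformContinuous_ramp (n q : ℝ) : UniformContinuous (ramp n q) := by
  have h : LipschitzWith ‖n‖₊ fun s : ℝ => n * (s - q) :=
    LipschitzWith.of_dist_le_mul fun a b => by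
      simp only [Real.dist_eq, coe_nnnorm, Real.norm_eq_abs, ← abs_mul]
      exact le_of_eq (by congr 1; ring)
  exact ((h.const_min (1 / 2)).const_max (-(1 / 2))).uniformContinuous

theorem ramp_eq_half {n q s : ℝ} (h : 1 / 2 ≤ n * (s - q)) : ramp n q s = 1 / 2 := by
  rw [ramp, min_eq_left h, max_eq_right (by norm_num)]

theorem ramp_eq_neg_half {n q s : ℝ} (h : n * (s - q) ≤ -(1 / 2)) :
    ramp n q s = -(1 / 2) := by
  rw [ramp, min_eq_right (by linarith), max_eq_left h]

/-- Ramps of integral slope and rational centre separate the points of the line. -/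
theorem exists_ramp_sub_ramp_eq_one {s t : ℝ} (h : s ≠ t) :
    ∃ (n : ℤ) (q : ℚ), ramp n q s - ramp n q t = 1 := by
  have key : ∀ {a b : ℝ}, a < b → ∃ (n : ℕ) (q : ℚ),
      (1 / 2 : ℝ) ≤ n * (b - q) ∧ (n : ℝ) * (a - q) ≤ -(1 / 2) := by
    intro a b hab
    obtain ⟨q, haq, hqb⟩ := exists_rat_btwn hab
    obtain ⟨m, hm⟩ := Archimedean.arch (1 / 2 : ℝ) (sub_pos.2 hqb)
    obtain ⟨k, hk⟩ := Archimedean.arch (1 / 2 : ℝ) (sub_pos.2 haq)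
    rw [nsmul_eq_mul] at hm hk
    -- The slope `m` suffices to the right of `q` and `k` to the left; the sum serves both sides.
    refine ⟨m + k, q, ?_, ?_⟩ <;> push_cast
    · nlinarith [mul_nonneg k.cast_nonneg (sub_pos.2 hqb).le]
    · nlinarith [mul_nonneg m.cast_nonneg (sub_pos.2 haq).le]
  rcases lt_or_gt_of_ne h with h | h
  · obtain ⟨n, q, h1, h2⟩ := key h
    -- A negative slope reverses the sign, so the difference is `1` in either order of the points.
    refine ⟨-n, q, ?_⟩
    rw [ramp_eq_half (by push_cast; linarith), ramp_eq_neg_half (by push_cast; linarith)]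
    norm_num
  · obtain ⟨n, q, h1, h2⟩ := key h
    refine ⟨n, q, ?_⟩
    rw [ramp_eq_half (by exact_mod_cast h1), ramp_eq_neg_half (by exact_mod_cast h2)]
    norm_num

/-- A field of constant direction `v` that depends only on the coordinate `⟪v, y⟫` is a
gradient. -/
theorem isConservative_ridge {h : ℝ → ℝ} (hh : Continuous h) (v : E d) :
    IsConservative fun y => h ⟪v, y⟫ • v := by
  have hder : ∀ s, HasDerivAt (fun s => ∫ τ in (0 : ℝ)..s, h τ) (h s) s := fun s =>
    (hh.integral_hasStrictDerivAt 0 s).hasDerivAt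
  have hC : ContDiff ℝ 1 fun s => ∫ τ in (0 : ℝ)..s, h τ := by
    rw [contDiff_one_iff_deriv]
    refine ⟨fun s => (hder s).differentiableAt, ?_⟩
    rwa [show deriv (fun s => ∫ τ in (0 : ℝ)..s, h τ) = h from funext fun s => (hder s).deriv]
  refine ⟨fun y => ∫ τ in (0 : ℝ)..⟪v, y⟫, h τ, hC.comp (innerSL ℝ v).contDiff, fun y => ?_⟩
  rw [hasGradientAt_iff_hasFDerivAt, map_smul]
  exact (hder ⟪v, y⟫).comp_hasFDerivAt y (innerSL ℝ v).hasFDerivAt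

theorem uniformContinuous_ridge {h : ℝ → ℝ} (hh : UniformContinuous h) (v : E d) :
    UniformContinuous fun y => h ⟪v, y⟫ • v :=
  (ContinuousLinearMap.toSpanSingleton ℝ v).uniformContinuous.comp
    (hh.comp (innerSL ℝ v).uniformContinuous)

theorem norm_ramp_smul_le (n q s : ℝ) (v : E d) : ‖ramp n q s • v‖ ≤ ‖v‖ := by
  rw [norm_smul, Real.norm_eq_abs]
  refine mul_le_of_le_one_left (norm_nonneg v) (abs_le.2 ⟨?_, ?_⟩)
  · linarith [neg_half_le_ramp n q s]
  · linarith [ramp_le_half n q s]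

/-! ### The Wulff shape of a convex, even and positively homogeneous function -/

/-- The Wulff shape of `k`. -/
def wulffShape (k : E d → ℝ) : Set (E d) := {v | ∀ ξ, ⟪v, ξ⟫ ≤ k ξ}

theorem convex_wulffShape (k : E d → ℝ) : Convex ℝ (wulffShape k) := by
  intro v hv w hw a b ha hb hab ξ
  rw [inner_add_left, real_inner_smul_left, real_inner_smul_left]
  calc a * ⟪v, ξ⟫ + b * ⟪w, ξ⟫ ≤ a * k ξ + b * k ξ :=
        add_le_add (mul_le_mul_of_nonneg_left (hv ξ) ha) (mul_le_mul_of_nonneg_left (hw ξ) hb)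
    _ = k ξ := by rw [← add_mul, hab, one_mul]

theorem map_zero_of_posHom {k : E d → ℝ}
    (hhom : ∀ (s : ℝ) (ξ : E d), 0 < s → k (s • ξ) = s * k ξ) : k 0 = 0 := by
  have := hhom 2 0 two_pos
  rw [smul_zero] at this
  linarith

/-- A positively homogeneous convex function is the support function of its Wulff shape. -/
theorem exists_mem_wulffShape_inner_eq {k : E d → ℝ} (hconv : ConvexOn ℝ univ k)
    (hhom : ∀ (s : ℝ) (ξ : E d), 0 < s → k (s • ξ) = s * k ξ) (ξ : E d) :
    ∃ v ∈ wulffShape k, ⟪v, ξ⟫ = k ξ := by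
  have hk0 := map_zero_of_posHom hhom
  -- Homogeneity turns midpoint convexity into subadditivity, as Hahn–Banach requires.
  have hadd : ∀ x y, k (x + y) ≤ k x + k y := fun x y => by
    have h := hconv.2 (mem_univ x) (mem_univ y) (by norm_num : (0 : ℝ) ≤ 1 / 2)
      (by norm_num : (0 : ℝ) ≤ 1 / 2) (by norm_num)
    rw [← smul_add, hhom _ _ (by norm_num), smul_eq_mul, smul_eq_mul] at h
    linarith
  rcases eq_or_ne ξ 0 with rfl | hξ
  -- At `ξ = 0` any element of the Wulff shape will do; extending the zero functional from the
  -- trivial subspace yields one.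
  · obtain ⟨g, -, hg⟩ := exists_extension_of_le_sublinear (⊥ : E d →ₗ.[ℝ] ℝ) k
      (fun c hc x => hhom c x hc) hadd (fun x => by
        obtain ⟨x, hx⟩ := x
        obtain rfl : x = 0 := (Submodule.mem_bot ℝ).1 hx
        exact (LinearPMap.map_zero _).le.trans hk0.ge)
    refine ⟨(InnerProductSpace.toDual ℝ (E d)).symm g.toContinuousLinearMap, fun η => ?_, ?_⟩
    · rw [InnerProductSpace.toDual_symm_apply]
      exact hg η
    · rw [inner_zero_right, hk0]
  · have hneg : -k ξ ≤ k (-ξ) := by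
      have := hadd ξ (-ξ)
      rw [add_neg_cancel, hk0] at this
      linarith
    obtain ⟨g, hgξ, hg⟩ := exists_extension_of_le_sublinear
      (LinearPMap.mkSpanSingleton ξ (k ξ) hξ) k (fun c hc x => hhom c x hc) hadd (by
        rintro ⟨x, hx⟩
        obtain ⟨a, rfl⟩ := Submodule.mem_span_singleton.1 hx
        have hval : LinearPMap.mkSpanSingleton ξ (k ξ) hξ ⟨a • ξ, hx⟩ = a • k ξ :=
          LinearPMap.mkSpanSingleton'_apply _ _ _ _ _
        rw [hval, smul_eq_mul]
        rcases lt_trichotomy a 0 with ha | rfl | ha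
        · have h := hhom (-a) (-ξ) (neg_pos.2 ha)
          rw [smul_neg, neg_smul, neg_neg] at h
          change a * k ξ ≤ k (a • ξ)
          rw [h]
          nlinarith
        · simp [hk0]
        · exact (hhom a ξ ha).ge)
    refine ⟨(InnerProductSpace.toDual ℝ (E d)).symm g.toContinuousLinearMap, fun η => ?_, ?_⟩
    · rw [InnerProductSpace.toDual_symm_apply]
      exact hg η
    · rw [InnerProductSpace.toDual_symm_apply]
      refine (hgξ ⟨ξ, Submodule.mem_span_singleton_self ξ⟩).trans ?_
      exact LinearPMap.mkSpanSingleton_apply ℝ ℝ hξ (k ξ)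

/-- By homogeneity `c * ‖ξ‖ ≤ k ξ`, and Cauchy–Schwarz concludes. This is how coercivity gives the
Wulff shape an interior. -/
theorem mem_wulffShape_of_norm_le {k : E d → ℝ}
    (hhom : ∀ (s : ℝ) (ξ : E d), 0 < s → k (s • ξ) = s * k ξ) {c : ℝ}
    (hkc : ∀ ξ, ‖ξ‖ = 1 → c ≤ k ξ) {v : E d} (hv : ‖v‖ ≤ c) : v ∈ wulffShape k := by
  intro ξ
  rcases eq_or_ne ξ 0 with rfl | hξ
  · rw [inner_zero_right, map_zero_of_posHom hhom]
  · have hn : 0 < ‖ξ‖ := norm_pos_iff.2 hξ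
    have h := hhom ‖ξ‖ (‖ξ‖⁻¹ • ξ) hn
    rw [smul_inv_smul₀ hn.ne'] at h
    rw [h]
    calc ⟪v, ξ⟫ ≤ ‖v‖ * ‖ξ‖ := real_inner_le_norm v ξ
      _ ≤ c * ‖ξ‖ := by gcongr
      _ ≤ k (‖ξ‖⁻¹ • ξ) * ‖ξ‖ := by
        gcongr
        exact hkc _ (norm_smul_inv_norm hξ)
      _ = ‖ξ‖ * k (‖ξ‖⁻¹ • ξ) := mul_comm _ _

/-- The Wulff shape of a coercive integrand is not thin: almost maximal vectors can be found off
any given hyperplane. -/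
theorem exists_mem_wulffShape_lt_inner {k : E d → ℝ} (hconv : ConvexOn ℝ univ k)
    (hhom : ∀ (s : ℝ) (ξ : E d), 0 < s → k (s • ξ) = s * k ξ) {c : ℝ} (hc : 0 < c)
    (hkc : ∀ ξ, ‖ξ‖ = 1 → c ≤ k ξ) {ξ e : E d} (he : e ≠ 0) {b : ℝ} (hb : b < k ξ) :
    ∃ v ∈ wulffShape k, b < ⟪v, ξ⟫ ∧ ⟪v, e⟫ ≠ 0 := by
  obtain ⟨v, hv, hvξ⟩ := exists_mem_wulffShape_inner_eq hconv hhom ξ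
  by_cases hve : ⟪v, e⟫ = 0
  swap
  · exact ⟨v, hv, hvξ ▸ hb, hve⟩
  have hn : 0 < ‖e‖ := norm_pos_iff.2 he
  -- `w` has norm `c`, hence lies in the Wulff shape. A short move from `v` towards `w` leaves the
  -- hyperplane `eᗮ` and keeps the product with `ξ` above `b`.
  set w : E d := (c / ‖e‖) • e with hw
  have hwk : w ∈ wulffShape k := mem_wulffShape_of_norm_le hhom hkc (by
    rw [hw, norm_smul, Real.norm_eq_abs, abs_of_pos (div_pos hc hn), div_mul_cancel₀ _ hn.ne'])
  have hwe : 0 < ⟪w, e⟫ := by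
    rw [hw, real_inner_smul_left, real_inner_self_eq_norm_sq]
    positivity
  have hlim : Tendsto (fun δ : ℝ => ⟪(1 - δ) • v + δ • w, ξ⟫) (𝓝[>] 0) (𝓝 (k ξ)) := by
    have hcont : Continuous fun δ : ℝ => ⟪(1 - δ) • v + δ • w, ξ⟫ := by fun_prop
    simpa [hvξ] using (hcont.tendsto 0).mono_left nhdsWithin_le_nhds
  obtain ⟨δ, hδb, hδ⟩ :=
    ((hlim.eventually_const_lt hb).and (Ioo_mem_nhdsGT (zero_lt_one' ℝ))).exists
  refine ⟨(1 - δ) • v + δ • w,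
    convex_wulffShape k hv hwk (by linarith [hδ.2]) hδ.1.le (by ring), hδb, ?_⟩
  rw [inner_add_left, real_inner_smul_left, real_inner_smul_left, hve, mul_zero, zero_add]
  exact (mul_pos hδ.1 hwe).ne'

/-- If `k` is even, then every difference of values of a ridge field with direction in the Wulff
shape stays in the Wulff shape. -/
theorem inner_ridge_sub_le {k : E d → ℝ} (heven : ∀ ξ, k (-ξ) = k ξ) {v : E d}
    (hv : v ∈ wulffShape k) {a b : ℝ} (hab : |a - b| ≤ 1) (ξ : E d) :
    ⟪a • v - b • v, ξ⟫ ≤ k ξ := by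
  have h1 := hv ξ
  have h2 := hv (-ξ)
  rw [inner_neg_right, heven] at h2
  rw [← sub_smul, real_inner_smul_left]
  calc (a - b) * ⟪v, ξ⟫ ≤ |a - b| * |⟪v, ξ⟫| := (le_abs_self _).trans (abs_mul _ _).le
    _ ≤ 1 * |⟪v, ξ⟫| := by gcongr
    _ ≤ k ξ := by rw [one_mul]; exact abs_le.2 ⟨by linarith, h1⟩

/-! ### ### The integrand off the diagonal -/

/-- The integrand that vanishes on the diagonal and is given off the diagonal by an even,
positively `1`-homogeneous, convex and coercive function is symmetric jointly convex. -/
theorem isSymmJointlyConvex_of_offDiag {k : E d → ℝ} (hk0 : ∀ ξ, 0 ≤ k ξ)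
    (heven : ∀ ξ, k (-ξ) = k ξ)
    (hhom : ∀ (s : ℝ) (ξ : E d), 0 < s → k (s • ξ) = s * k ξ) (hconv : ConvexOn ℝ univ k)
    {c : ℝ} (hc : 0 < c) (hkc : ∀ ξ, ‖ξ‖ = 1 → c ≤ k ξ) {f : E d → E d → E d → ℝ}
    (hf : ∀ r t ξ, r ≠ t → f r t ξ = k ξ) (hdiag : ∀ r ξ, f r r ξ = 0) :
    IsSymmJointlyConvex f := by
  have hne : (wulffShape k).Nonempty :=
    ⟨0, mem_wulffShape_of_norm_le hhom hkc (by rw [norm_zero]; exact hc.le)⟩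
  have : Nonempty (wulffShape k) := hne.to_subtype
  let v : ℕ → wulffShape k := TopologicalSpace.denseSeq (wulffShape k)
  obtain ⟨p, hp⟩ := exists_surjective_nat (ℕ × ℤ × ℚ)
  let g : ℕ × ℤ × ℚ → E d → E d := fun i y =>
    ramp i.2.1 i.2.2 ⟪(v i.1 : E d), y⟫ • (v i.1 : E d)
  refine ⟨fun r t ξ => ?_, fun j => g (p j), fun j => ⟨?_, ?_, ?_⟩, fun r t ξ => ?_⟩
  · rcases eq_or_ne r t with rfl | h
    · rw [hdiag]
    · rw [hf r t ξ h]
      exact hk0 ξ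
  · exact uniformContinuous_ridge (uniformContinuous_ramp _ _) _
  · exact ⟨‖(v (p j).1 : E d)‖, fun r => norm_ramp_smul_le _ _ _ _⟩
  · exact isConservative_ridge (uniformContinuous_ramp _ _).continuous _
  rcases eq_or_ne r t with rfl | hrt
  · simp only [sub_self, inner_zero_left, range_const, hdiag]
    exact isLUB_singleton
  rw [hf r t ξ hrt]
  refine isLUB_iff_le_iff.2 fun b => ⟨?_, ?_⟩
  · rintro hb _ ⟨j, rfl⟩
    refine (inner_ridge_sub_le heven (v (p j).1).2 (abs_le.2 ⟨?_, ?_⟩) ξ).trans hb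
    · linarith [neg_half_le_ramp (p j).2.1 (p j).2.2 ⟪(v (p j).1 : E d), r⟫,
        ramp_le_half (p j).2.1 (p j).2.2 ⟪(v (p j).1 : E d), t⟫]
    · linarith [neg_half_le_ramp (p j).2.1 (p j).2.2 ⟪(v (p j).1 : E d), t⟫,
        ramp_le_half (p j).2.1 (p j).2.2 ⟪(v (p j).1 : E d), r⟫]
  · intro hb
    by_contra! hlt
    obtain ⟨w, hw, hwb, hwe⟩ :=
      exists_mem_wulffShape_lt_inner hconv hhom hc hkc (sub_ne_zero.2 hrt) hlt
    have hcont : ∀ η : E d, Continuous fun z : wulffShape k => ⟪(z : E d), η⟫ := fun η => by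
      fun_prop
    -- Both conditions on `w` are open, so a member of the dense sequence satisfies them too.
    have hopen : IsOpen {z : wulffShape k | b < ⟪(z : E d), ξ⟫ ∧ ⟪(z : E d), r - t⟫ ≠ 0} :=
      (isOpen_lt continuous_const (hcont ξ)).inter
        (isOpen_ne_fun (hcont (r - t)) continuous_const)
    obtain ⟨i, hib, hie⟩ :=
      (TopologicalSpace.denseRange_denseSeq (wulffShape k)).exists_mem_open hopen
        ⟨⟨w, hw⟩, hwb, hwe⟩
    rw [inner_sub_right, sub_ne_zero] at hie
    obtain ⟨n, q, hnq⟩ := exists_ramp_sub_ramp_eq_one hie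
    obtain ⟨j, hj⟩ := hp (i, n, q)
    have h := hb ⟨j, rfl⟩
    simp only [hj, g, ← sub_smul] at h
    change ⟪(ramp n q ⟪(v i : E d), r⟫ - ramp n q ⟪(v i : E d), t⟫) • (v i : E d), ξ⟫ ≤ b at h
    rw [show ramp n q ⟪(v i : E d), r⟫ - ramp n q ⟪(v i : E d), t⟫ = 1 from hnq, one_smul] at h
    exact h.not_gt hib

/-- Off-diagonal extension of a BV family by zero on the diagonal. -/
theorem IsBVFamilyWith.offDiag {Ω N : Set (E d)} (hΩ : IsOpen Ω) {κ : E d → E d → ℝ}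
    (hκ : IsBVFamilyWith Ω N κ) {φ : E d → E d → E d → E d → ℝ}
    (hφ : ∀ x ∈ Ω, ∀ r t ξ, r ≠ t → φ x r t ξ = κ x ξ)
    (hdiag : ∀ x ∈ Ω, ∀ r ξ, φ x r r ξ = 0) :
    IsBVFamilyWith Ω N (fun x (p : E d × E d × E d) => φ x p.1 p.2.1 p.2.2) := by
  obtain ⟨hBV, hsub, hmeas, hnull, hlim⟩ := hκ
  refine ⟨?_, hsub, hmeas, hnull, ?_⟩
  · rintro ⟨r, t, ξ⟩
    rcases eq_or_ne r t with rfl | h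
    · exact (IsBV.zero Ω).congr hΩ.measurableSet fun x hx => hdiag x hx r ξ
    · exact (hBV ξ).congr hΩ.measurableSet fun x hx => hφ x hx r t ξ h
  · rintro x hx ⟨r, t, ξ⟩
    rcases eq_or_ne r t with rfl | h
    · simp only [hdiag x hx.1]
      exact (isLowerApproxLimit_zero x).congr hΩ (fun y hy => hdiag y hy r ξ) hx.1
    · simp only [hφ x hx.1 r t ξ h]
      exact (hlim x hx ξ).congr hΩ (fun y hy => hφ y hy r t ξ h) hx.1

end SurfaceIntegrand

theorem proposition5p2 {d : ℕ} (hd : 1 ≤ d)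
    (Ω : Set (SurfaceIntegrand.E d)) (hΩo : IsOpen Ω) (hΩb : Bornology.IsBounded Ω)
    (κ : SurfaceIntegrand.E d → SurfaceIntegrand.E d → ℝ)
    (hκ0 : ∀ x ∈ Ω, ∀ ξ, 0 ≤ κ x ξ)
    -- `κ(·, ξ)` is BV and equals its lower approximate limit off a common null set
    (hκBV : ∃ N : Set (SurfaceIntegrand.E d), SurfaceIntegrand.IsBVFamilyWith Ω N κ)
    -- `κ(x, ·)` is even, positively 1-homogeneous and convex
    (hκeven : ∀ x ∈ Ω, ∀ ξ, κ x (-ξ) = κ x ξ)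
    (hκhom : ∀ x ∈ Ω, ∀ (s : ℝ) (ξ : SurfaceIntegrand.E d), 0 < s → κ x (s • ξ) = s * κ x ξ)
    (hκconv : ∀ x ∈ Ω, ConvexOn ℝ Set.univ (κ x))
    (φ : SurfaceIntegrand.E d → SurfaceIntegrand.E d → SurfaceIntegrand.E d →
      SurfaceIntegrand.E d → ℝ)
    (hφ : ∀ x ∈ Ω, ∀ r t ξ, r ≠ t → φ x r t ξ = κ x ξ)
    (hφdiag : ∀ x ∈ Ω, ∀ r ξ, φ x r r ξ = 0)
    (c : ℝ) (hc : 0 < c)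
    (hφc : ∀ x ∈ Ω, ∀ r t ξ, r ≠ t → ‖ξ‖ = 1 → c ≤ φ x r t ξ) :
    SurfaceIntegrand.IsBVSymmJointlyConvex Ω φ := by
  obtain ⟨N, hN⟩ := hκBV
  have : Nonempty (Fin d) := ⟨⟨0, hd⟩⟩
  -- A pair off the diagonal, available since `1 ≤ d`, transfers the lower bound from `φ` to `κ`.
  obtain ⟨t₀, ht₀⟩ := exists_ne (0 : SurfaceIntegrand.E d)
  have hκc : ∀ x ∈ Ω, ∀ ξ, ‖ξ‖ = 1 → c ≤ κ x ξ := fun x hx ξ hξ =>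
    hφ x hx 0 t₀ ξ ht₀.symm ▸ hφc x hx 0 t₀ ξ ht₀.symm hξ
  have hsymm : ∀ x ∈ Ω, SurfaceIntegrand.IsSymmJointlyConvex (φ x) := fun x hx =>
    SurfaceIntegrand.isSymmJointlyConvex_of_offDiag (hκ0 x hx) (hκeven x hx) (hκhom x hx)
      (hκconv x hx) hc (hκc x hx) (hφ x hx) (hφdiag x hx)
  refine ⟨fun x hx => (hsymm x hx).1, N, hN.offDiag hΩo hφ hφdiag,
    fun x hx => hsymm x hx.1, 1, one_pos, fun x hx r s t ξ hrt hst => ?_⟩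
  -- Off the diagonal `φ` does not depend on the traces, so any positive constant would do.
  rw [hφ x hx.1 r t ξ hrt, hφ x hx.1 s t ξ hst, sub_self, abs_zero]
  positivity
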